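/- Let $G$ be a countable discrete sofic group with a fixed sofic approximation $\Sigma=\{\sigma_i:G\to \mathrm{Sym}(d_i)\}_{i\in\mathbb N}$, that is, $d_i\to\infty$, $\frac1{d_i}|\{a:\sigma_{i,s}\sigma_{i,t}(a)=\sigma_{i,st}(a)\}|\to1$ for all $s,t\in G$, and $\frac1{d_i}|\{a:\sigma_{i,s}(a)\ne\sigma_{i,t}(a)\}|\to1$ for all distinct $s,t\in G$. Let $G$ act by homeomorphisms on a compact metric space $(X,\rho)$, and let the action be expansive: there is $\delta>0$ such that for all $x\neq y$ in $X$ some $g\in G$ satisfies $\rho(gx,gy)>\delta$. Let $M(X,G)$ be the space of $G$-invariant Borel probability measures on $X$ with the weak-* topology, and assume $M(X,G)\ne\emptyset$. For $\mu\in M(X,G)$, a finite Borel partition $\alpha=\{A_1,\dots,A_k\}$ of $X$, a non-empty finite set $F\subset G$ and $\varepsilon>0$, let $AP_\mu(\sigma_i,\alpha:F,\varepsilon)$ be the set of ordered partitions $\beta=\{B_1,\dots,B_k\}$ (with empty parts allowed) of $\{1,\dots,d_i\}$ such that $$\sum_{\phi:F\to\{1,\dots,k\}}\Big|\mu\Big(\bigcap_{f\in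 F}f^{-1}A_{\phi(f)}\Big)-\frac1{d_i}\Big|\bigcap_{f\in F}\sigma_{i,f}^{-1}B_{\phi(f)}\Big|\Big|\le\varepsilon ,$$ and put $$h_{\mu,\Sigma}(\alpha)=\inf_{F}\inf_{\varepsilon>0}\limsup_{i\to\infty}\frac1{d_i}\log|AP_\mu(\sigma_i,\alpha:F,\varepsilon)|\in[-\infty,\infty),\qquad \log 0=-\infty .$$ Call $\alpha$ generating for $\mu$ if every Borel set agrees up to a $\mu$-null set with an element of the smallest $G$-invariant $\sigma$-algebra containing $\alpha$. Then: 1. For every $\mu\in M(X,G)$ there is a finite Borel partition that is generating for $\mu$, and $h_{\mu,\Sigma}(\alpha)$ has the same value for all such partitions $\alpha$. This common value is L. Bowen's sofic measure entropy $h_{\mu,\Sigma}(X,G)$, and it lies in $[0,\infty)\cup\{-\infty\}$. 2. The function $\mu\mapsto h_{\mu,\Sigma}(X,G)$ is upper semicontinuous on $M(X,G)$. 3. The action admits a measure of maximal entropy: there is $\mu\in M(X,G)$ with $h_{\nu,\Sigma}(X,G)\le h_{\mu,\Sigma}(X,G)$ for all $\nu\in M(X,G)$. -/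

import Mathlib

open MeasureTheory Filter Topology
open scoped ENNReal

namespace SoficEntropy

/-- A sofic approximation of the group `G`: a sequence of maps `σ i : G → Sym (d i)` with
`d i → ∞` which is asymptotically multiplicative and asymptotically free. -/
structure SoficApproximation (G : Type*) [Group G] where
  d : ℕ → ℕ
  σ : ∀ i : ℕ, G → Equiv.Perm (Fin (d i))
  tendsto_d : Tendsto d atTop atTop
  asymp_mul : ∀ s t : G, Tendsto
    (fun i => (({a : Fin (d i) | σ i s (σ i t a) = σ i (s * t) a}.ncard : ℝ) / (d i : ℝ)))
    atTop (𝓝 1)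
  asymp_free : ∀ s t : G, s ≠ t → Tendsto
    (fun i => (({a : Fin (d i) | σ i s a ≠ σ i t a}.ncard : ℝ) / (d i : ℝ)))
    atTop (𝓝 1)

/-- The action of `G` on the metric space `X` is expansive. -/
def IsExpansive (G X : Type*) [Group G] [MetricSpace X] [MulAction G X] : Prop :=
  ∃ δ : ℝ, 0 < δ ∧ ∀ x y : X, x ≠ y → ∃ g : G, δ < dist (g • x) (g • y)

/-- The space `M(X, G)` of `G`-invariant Borel probability measures on `X`, with the topology
induced by the weak-* topology on `ProbabilityMeasure X`. -/
abbrev InvariantMeasures (G X : Type*) [Group G] [MulAction G X] [MeasurableSpace X] : Type _ :=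
  {μ : ProbabilityMeasure X // ∀ (g : G) (A : Set X), MeasurableSet A →
    (μ : Measure X) ((fun x => g • x) ⁻¹' A) = (μ : Measure X) A}

section Entropy

variable {G X : Type*} [Group G] [MulAction G X] [MeasurableSpace X]

/-- `A_φ = ⋂_{f ∈ F} f⁻¹ A_{φ f}`. A finite partition `{A_1, …, A_k}` of `X` is encoded by the
map `α : X → Fin k` with `A_j = α⁻¹ {j}`; the partition is Borel iff `α` is measurable. -/
def partCylinder {k : ℕ} (α : X → Fin k) (F : Finset G) (φ : F → Fin k) : Set X :=
  {x | ∀ f : F, α ((f : G) • x) = φ f}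

/-- `B_φ = ⋂_{f ∈ F} σ(f)⁻¹ B_{φ f}`, where the partition `{B_1, …, B_k}` of the `d`-point set
is encoded by the map `β : Fin d → Fin k` with `B_j = β⁻¹ {j}`. -/
def modelCylinder {d k : ℕ} (σ : G → Equiv.Perm (Fin d)) (β : Fin d → Fin k) (F : Finset G)
    (φ : F → Fin k) : Set (Fin d) :=
  {a | ∀ f : F, β (σ (f : G) a) = φ f}

open Classical in
/-- `d_F(α, β) = ∑_φ |μ(A_φ) - ζ(B_φ)|` with `ζ` the uniform probability on the `d` points. -/
noncomputable def partitionDist (μ : Measure X) {d k : ℕ} (σ : G → Equiv.Perm (Fin d))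
    (α : X → Fin k) (F : Finset G) (β : Fin d → Fin k) : ℝ :=
  ∑ φ : F → Fin k, |μ.real (partCylinder α F φ) - ((modelCylinder σ β F φ).ncard : ℝ) / (d : ℝ)|

/-- `AP_μ(σ, α : F, ε)`. -/
def AP (μ : Measure X) {d k : ℕ} (σ : G → Equiv.Perm (Fin d)) (α : X → Fin k)
    (F : Finset G) (ε : ℝ) : Set (Fin d → Fin k) :=
  {β | partitionDist μ σ α F β ≤ ε}

/-- `H_{μ,Σ}(α : F, ε) = limsup_i (1/d_i) log |AP_μ(σ_i, α : F, ε)|`, with `log 0 = -∞`. -/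
noncomputable def entropyAt (S : SoficApproximation G) (μ : Measure X) {k : ℕ} (α : X → Fin k)
    (F : Finset G) (ε : ℝ) : EReal :=
  limsup (fun i => ENNReal.log ((AP μ (S.σ i) α F ε).ncard : ℝ≥0∞) / (S.d i : EReal)) atTop

/-- `h_{μ,Σ}(α) = inf_F inf_{ε > 0} H_{μ,Σ}(α : F, ε)`, over non-empty finite `F ⊆ G`. -/
noncomputable def partitionEntropy (S : SoficApproximation G) (μ : Measure X) {k : ℕ}
    (α : X → Fin k) : EReal :=
  ⨅ (F : Finset G) (_ : F.Nonempty) (ε : ℝ) (_ : 0 < ε), entropyAt S μ α F ε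

/-- The smallest `G`-invariant σ-algebra containing the partition `α`: it is generated by the
translates `g⁻¹ A_j`. -/
abbrev generatedAlgebra (G : Type*) {X : Type*} [Group G] [MulAction G X] {k : ℕ}
    (α : X → Fin k) : MeasurableSpace X :=
  MeasurableSpace.generateFrom {A | ∃ (g : G) (j : Fin k), A = {x | α (g • x) = j}}

/-- `α` is a finite Borel partition which generates the Borel σ-algebra in the sense of `μ`. -/
def IsGenerating (G : Type*) {X : Type*} [Group G] [MulAction G X] [MeasurableSpace X]
    (μ : Measure X) {k : ℕ} (α : X → Fin k) : Prop :=
  Measurable α ∧ ∀ B : Set X, MeasurableSet B →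
    ∃ A : Set X, MeasurableSet[generatedAlgebra G α] A ∧ μ (symmDiff A B) = 0

/-- The sofic measure entropy `h_{μ,Σ}(X, G)`: the value of `h_{μ,Σ}(α)` at finite generating
partitions `α`. That the value does not depend on `α` is not built into the definition, so the
infimum over all of them is taken here. -/
noncomputable def soficEntropy (S : SoficApproximation G) (μ : Measure X) : EReal :=
  ⨅ (k : ℕ) (α : X → Fin k) (_ : IsGenerating G μ α), partitionEntropy S μ α

end Entropy

end SoficEntropy

/-! The name of a point is its sequence of labels along the orbit. When a partition generates, Borel
sets are read off from names modulo null sets, and such a reading is approximated through a finite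
window. So for generating `α` and `β` there are finitary maps `q` and `p` with `q` of the `β`-name
close to `α` and `p` of the `α`-name close to `β`. Applying `q` to a good `β`-microstate gives a
good `α`-microstate, because the sofic maps are almost multiplicative, and `p` recovers the original
off few points. The fibres of this recoding lie in small Hamming balls, of size at most `exp (κ d)`
with `κ` arbitrarily small; hence the entropies agree (`eventually_card_AP_le`,
`partitionEntropy_le`).

For fixed `μ`, expansiveness gives a partition cut out by small balls with `μ`-null frontiers. Its
names separate points, so it generates for every measure, while its cylinders are continuity sets of
`μ` (`exists_isGenerating_locallyConstant`). Nearby invariant `ν` have almost the same cylinder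
masses, so a microstate for `ν` at tolerance `ε / 2` is one for `μ` at `ε`: this is upper
semicontinuity. A maximum exists since the space of invariant measures is compact. -/

namespace SoficEntropy

/-! ### Names of points and finite windows -/

section Itinerary

variable {G X : Type*} [Group G] [MulAction G X]

/-- The `α`-name of a point: the sequence of labels along its orbit. -/
def itinerary (G : Type*) {X : Type*} [Group G] [MulAction G X] {k : ℕ} (α : X → Fin k) (x : X) :
    G → Fin k :=
  fun g => α (g • x)

/-- The name of a point of the `d`-point set under a labelling `b`. -/
def modelItinerary {G : Type*} {d k : ℕ} (σ : G → Equiv.Perm (Fin d)) (b : Fin d → Fin k)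
    (v : Fin d) : G → Fin k :=
  fun g => b (σ g v)

/-- The translate of a configuration. -/
def shift {G : Type*} [Group G] {k : ℕ} (h : G) (c : G → Fin k) : G → Fin k := fun g => c (g * h)

/-- The sliding block code with block map `q`. -/
def blockCode {G : Type*} [Group G] {k l : ℕ} (q : (G → Fin l) → Fin k) (c : G → Fin l) :
    G → Fin k :=
  fun h => q (shift h c)

lemma itinerary_smul {k : ℕ} (α : X → Fin k) (h : G) (x : X) :
    itinerary G α (h • x) = shift h (itinerary G α x) := by
  funext g
  simp [itinerary, shift, mul_smul]

/-- Moves questions about the generated σ-algebra to the product space of names, where cylinders and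
images are available. -/
theorem generatedAlgebra_eq_comap {k : ℕ} (α : X → Fin k) :
    generatedAlgebra G α = MeasurableSpace.comap (itinerary G α) MeasurableSpace.pi := by
  apply le_antisymm
  · refine MeasurableSpace.generateFrom_le ?_
    rintro A ⟨g, j, rfl⟩
    refine ⟨{c | c g = j}, ?_, rfl⟩
    exact (measurable_pi_apply (X := fun _ : G => Fin k) g) (measurableSet_singleton j)
  · rw [← measurable_iff_comap_le]
    refine @measurable_pi_lambda _ _ _ (generatedAlgebra G α) _ _ fun g => ?_
    refine @measurable_to_countable' _ _ _ _ (generatedAlgebra G α) _ fun j => ?_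
    exact MeasurableSpace.measurableSet_generateFrom ⟨g, j, rfl⟩

variable [MeasurableSpace X]

lemma measurable_itinerary {k : ℕ} {α : X → Fin k} (hα : Measurable α)
    (hG : ∀ g : G, Measurable fun x : X => g • x) : Measurable (itinerary G α) :=
  measurable_pi_lambda _ fun g => hα.comp (hG g)

/-- Functions of finitely many coordinates are measurable. -/
lemma _root_.DependsOn.measurable {G : Type*} {k : ℕ} {Y : Type*} [MeasurableSpace Y]
    {p : (G → Fin k) → Y} {E : Finset G} (hp : DependsOn p (E : Set G)) : Measurable p := by
  rcases isEmpty_or_nonempty Y with hY | hY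
  · have : IsEmpty (G → Fin k) := ⟨fun c => hY.elim (p c)⟩
    exact measurable_of_empty p
  obtain ⟨r, rfl⟩ := dependsOn_iff_exists_comp.1 hp
  have hr : Measurable r := measurable_of_countable r
  exact hr.comp (measurable_pi_lambda _ fun g => measurable_pi_apply _)

/-- A set in the algebra generated by `α` is approximated by a set that depends on finitely many
coordinates of the `α`-name. -/
theorem exists_finitary_approx (μ : Measure X) [IsFiniteMeasure μ] {k : ℕ} {α : X → Fin k}
    (hα : Measurable (itinerary G α)) {A : Set X} (hA : MeasurableSet[generatedAlgebra G α] A)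
    {ε : ℝ} (hε : 0 < ε) :
    ∃ (E : Finset G) (P : Set (G → Fin k)), DependsOn (· ∈ P) (E : Set G) ∧
      μ.real (symmDiff (itinerary G α ⁻¹' P) A) < ε := by
  rw [generatedAlgebra_eq_comap] at hA
  obtain ⟨B, hB, rfl⟩ := hA
  -- The ring of cylinders generates the product σ-algebra, so it approximates `B` under the law of
  -- the name.
  obtain ⟨P, hP, hlt⟩ := exists_measure_symmDiff_lt_of_generateFrom_isSetRing
    (μ := μ.map (itinerary G α)) (isSetRing_measurableCylinders (α := fun _ : G => Fin k))
    ⟨{Set.univ}, by simp, by simpa using univ_mem_measurableCylinders (fun _ : G => Fin k), by simp⟩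
    generateFrom_measurableCylinders.symm hB (ENNReal.ofReal_pos.2 hε)
  have hPm := MeasurableSet.of_mem_measurableCylinders hP
  obtain ⟨E, S, -, rfl⟩ := (mem_measurableCylinders P).1 hP
  refine ⟨E, cylinder E S, ?_, ?_⟩
  · intro x y hxy
    have : E.restrict x = E.restrict y := funext fun i => hxy i i.2
    simp only [mem_cylinder, this]
  · rw [Measure.map_apply hα (hPm.symmDiff hB)] at hlt
    exact (ENNReal.lt_ofReal_iff_toReal_lt (measure_ne_top _ _)).1 hlt

/-- If `α` generates, every finite Borel partition is, off a small set, a finitary function of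
the `α`-name. -/
theorem IsGenerating.exists_block_approx {μ : Measure X} [IsProbabilityMeasure μ] {k l : ℕ}
    {α : X → Fin k} (hα : IsGenerating G μ α) (hG : ∀ g : G, Measurable fun x : X => g • x)
    {β : X → Fin l} (hβ : Measurable β) {ε : ℝ} (hε : 0 < ε) :
    ∃ (E : Finset G) (p : (G → Fin k) → Fin l), DependsOn p (E : Set G) ∧
      μ.real {x | β x ≠ p (itinerary G α x)} < ε := by
  classical
  have hαm := measurable_itinerary hα.1 hG
  obtain ⟨x₀⟩ : Nonempty X := μ.nonempty_of_neZero
  have hl : 0 < l := (β x₀).pos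
  have key (j : Fin l) : ∃ (E : Finset G) (P : Set (G → Fin k)), DependsOn (· ∈ P) (E : Set G) ∧
      μ.real (symmDiff (itinerary G α ⁻¹' P) (β ⁻¹' {j})) < ε / l := by
    obtain ⟨A, hA, h0⟩ := hα.2 (β ⁻¹' {j}) (hβ (measurableSet_singleton j))
    obtain ⟨E, P, hP, hlt⟩ := exists_finitary_approx μ hαm hA (ε := ε / l) (by positivity)
    refine ⟨E, P, hP, lt_of_le_of_lt ?_ hlt⟩
    have h0' : μ.real (symmDiff A (β ⁻¹' {j})) = 0 := by simp [Measure.real, h0]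
    linarith [measureReal_symmDiff_le (μ := μ) (s := itinerary G α ⁻¹' P) (t := A)
      (β ⁻¹' {j})]
  choose E P hP hlt using key
  -- The output is some `j` with `c ∈ P j`, or the arbitrary label `β x₀` if there is none. A wrong
  -- output puts `x` in the symmetric difference of the chosen label, or of the label `β x` if none
  -- was available.
  refine ⟨Finset.univ.biUnion E, fun c => if h : ∃ j, c ∈ P j then h.choose else β x₀, ?_, ?_⟩
  · intro c c' hcc
    have : ∀ j, (c ∈ P j) = (c' ∈ P j) := fun j => hP j fun g hg => hcc g (by
      simp only [Finset.coe_biUnion, Set.mem_iUnion]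
      exact ⟨j, by simp, hg⟩)
    simp only [this]
  · have hsub : {x | β x ≠ (fun c => if h : ∃ j, c ∈ P j then h.choose else β x₀)
        (itinerary G α x)} ⊆ ⋃ j ∈ Finset.univ, symmDiff (itinerary G α ⁻¹' P j) (β ⁻¹' {j}) := by
      intro x hx
      simp only [Set.mem_ofPred_eq] at hx
      simp only [Finset.mem_univ, Set.iUnion_true, Set.mem_iUnion, Set.mem_symmDiff]
      split_ifs at hx with h
      · exact ⟨h.choose, Or.inl ⟨h.choose_spec, fun h' => hx h'⟩⟩
      · exact ⟨β x, Or.inr ⟨rfl, fun h' => h ⟨_, h'⟩⟩⟩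
    calc _ ≤ μ.real (⋃ j ∈ Finset.univ, symmDiff (itinerary G α ⁻¹' P j) (β ⁻¹' {j})) :=
          measureReal_mono hsub (measure_ne_top _ _)
      _ ≤ ∑ j, μ.real (symmDiff (itinerary G α ⁻¹' P j) (β ⁻¹' {j})) :=
          measureReal_biUnion_finset_le _ _
      _ < ∑ _j : Fin l, ε / l :=
          Finset.sum_lt_sum_of_nonempty ⟨β x₀, by simp⟩ fun j _ => hlt j
      _ = ε := by
          have : (l : ℝ) ≠ 0 := by positivity
          simp; field_simp

end Itinerary

/-! ### Generating partitions of an expansive action -/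

section Existence

variable {G X : Type*} [Group G] [MulAction G X]

/-- A finite Borel partition whose names separate points generates. -/
theorem isGenerating_of_injective [Countable G] [MeasurableSpace X] [StandardBorelSpace X]
    (hG : ∀ g : G, Measurable fun x : X => g • x) {k : ℕ} {α : X → Fin k} (hα : Measurable α)
    (hinj : Function.Injective (itinerary G α)) (μ : Measure X) : IsGenerating G μ α := by
  refine ⟨hα, fun B hB => ⟨B, ?_, by simp⟩⟩
  rw [generatedAlgebra_eq_comap]
  -- Lusin–Souslin: the injective name map is a measurable embedding, so `B` is the preimage of its
  -- measurable image.
  have hemb := (measurable_itinerary hα hG).measurableEmbedding hinj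
  exact ⟨itinerary G α '' B, hemb.measurableSet_image' hB, hinj.preimage_image B⟩

/-- For an expansive action and a finite measure `μ` there is a partition which is generating for
every measure and whose labelling is locally constant off a `μ`-null set. -/
theorem exists_isGenerating_locallyConstant [Countable G] [MetricSpace X] [CompactSpace X]
    [MeasurableSpace X] [BorelSpace X] [ContinuousConstSMul G X] (hexp : IsExpansive G X)
    (μ : Measure X) [IsFiniteMeasure μ] :
    ∃ (k : ℕ) (α : X → Fin k), (∀ ν : Measure X, IsGenerating G ν α) ∧
      ∃ N : Set X, MeasurableSet N ∧ μ N = 0 ∧ ∀ x ∉ N, ∀ᶠ y in 𝓝 x, α y = α x := by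
  classical
  obtain ⟨δ, hδ, hsep⟩ := hexp
  -- Radii below `δ / 2` keep two points of one ball within `δ`, so distinct points get distinct
  -- names.
  have hr (x : X) : ∃ r ∈ Set.Ioo 0 (δ / 2), μ (frontier (Metric.thickening r {x})) = 0 :=
    exists_null_frontier_thickening μ {x} (by positivity)
  choose r hr0 hr1 using hr
  let U : X → Set X := fun x => Metric.ball x (r x)
  have hU (x : X) : μ (frontier (U x)) = 0 := by
    have := hr1 x
    rwa [Metric.thickening_singleton] at this
  obtain ⟨t, ht⟩ := isCompact_univ.elim_finite_subcover U (fun x => Metric.isOpen_ball)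
    (fun x _ => Set.mem_iUnion.2 ⟨x, Metric.mem_ball_self (hr0 x).1⟩)
  let e : (t → Prop) ≃ Fin (Fintype.card (t → Prop)) := Fintype.equivFin _
  let α : X → Fin (Fintype.card (t → Prop)) := fun x => e fun i => x ∈ U i
  have hmem {x y : X} (h : α x = α y) (i : t) : x ∈ U i ↔ y ∈ U i :=
    iff_of_eq (congrFun (e.injective h) i)
  have hα : Measurable α := by
    refine (measurable_of_countable e).comp (measurable_pi_lambda _ fun i => ?_)
    exact measurable_mem.2 Metric.isOpen_ball.measurableSet
  refine ⟨_, α, isGenerating_of_injective (fun g => (continuous_const_smul g).measurable) hα ?_,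
    ⋃ i ∈ t, frontier (U i), ?_, ?_, ?_⟩
  · intro x y hxy
    by_contra hne
    obtain ⟨g, hg⟩ := hsep x y hne
    obtain ⟨i, hi, hx⟩ := Set.mem_iUnion₂.1 (ht (Set.mem_univ (g • x)))
    have hy := (hmem (congrFun hxy g) ⟨i, hi⟩).1 hx
    have h1 := dist_triangle_right (g • x) (g • y) i
    have h2 : dist (g • x) i < r i := hx
    have h3 : dist (g • y) i < r i := hy
    have h4 := (hr0 i).2
    linarith
  · exact Finset.measurableSet_biUnion _ fun i _ => isClosed_frontier.measurableSet
  · exact (measure_biUnion_null_iff t.countable_toSet).2 fun i _ => hU i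
  · intro x hx
    have : ∀ i : t, ∀ᶠ y in 𝓝 x, (y ∈ U i ↔ x ∈ U i) := by
      intro i
      have hxi : x ∉ frontier (U i) := fun h => hx (Set.mem_iUnion₂.2 ⟨i, i.2, h⟩)
      by_cases hxU : x ∈ U i
      · filter_upwards [Metric.isOpen_ball.mem_nhds hxU] with y hy
        exact iff_of_true hy hxU
      · have : x ∉ closure (U i) := fun h =>
          hxi ⟨h, fun h' => hxU (interior_subset h')⟩
        filter_upwards [isClosed_closure.isOpen_compl.mem_nhds this] with y hy
        exact iff_of_false (fun h => hy (subset_closure h)) hxU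
    filter_upwards [eventually_all.2 this] with y hy
    exact congrArg e (funext fun i => propext (hy i))

end Existence

/-! ### Size of Hamming balls -/

section Hamming

/-- Hamming balls of small relative radius have small exponential size. -/
theorem exists_card_hammingBall_le (l : ℕ) {κ : ℝ} (hκ : 0 < κ) :
    ∃ θ : ℝ, 0 < θ ∧ ∀ (d : ℕ) (c : Fin d → Fin l),
      (({b : Fin d → Fin l | ({v | b v ≠ c v}.ncard : ℝ) ≤ θ * d}.ncard : ℕ) : ℝ) ≤
        Real.exp (κ * d) := by
  classical
  -- Each word is weighted by `exp (-L)` per disagreement with `c`. This `L` bounds the weight per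
  -- coordinate by `1 + κ / 2`, hence the total by `exp (κ d / 2)`, while `θ` is small enough that
  -- each word of the ball weighs at least `exp (-κ d / 2)`.
  obtain ⟨L, hL0, hL⟩ : ∃ L : ℝ, 0 ≤ L ∧ l * Real.exp (-L) ≤ κ / 2 := by
    have h : Tendsto (fun L : ℝ => l * Real.exp (-L)) atTop (𝓝 (l * 0)) :=
      Real.tendsto_exp_neg_atTop_nhds_zero.const_mul _
    rw [mul_zero] at h
    obtain ⟨L, h1, h2⟩ := ((h.eventually_le_const (half_pos hκ)).and (eventually_ge_atTop 0)).exists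
    exact ⟨L, h2, h1⟩
  have hθL : κ / (2 * (L + 1)) * L ≤ κ / 2 := by
    rw [div_mul_eq_mul_div, div_le_div_iff₀ (by positivity) (by positivity)]
    nlinarith
  refine ⟨κ / (2 * (L + 1)), by positivity, fun d c => ?_⟩
  set θ := κ / (2 * (L + 1))
  let w : (Fin d → Fin l) → ℝ := fun b => ∏ v, if b v = c v then 1 else Real.exp (-L)
  have hw0 (b) : 0 ≤ w b := Finset.prod_nonneg fun v _ => by split_ifs <;> positivity
  have hwsum : ∑ b, w b ≤ Real.exp (κ / 2 * d) := by
    have h1 : ∑ b, w b = ∏ v : Fin d, ∑ j : Fin l, if j = c v then 1 else Real.exp (-L) := by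
      rw [Finset.prod_univ_sum, Fintype.piFinset_univ]
    have h2 (v : Fin d) : (∑ j : Fin l, if j = c v then 1 else Real.exp (-L)) ≤
        Real.exp (κ / 2) := by
      calc (∑ j : Fin l, if j = c v then 1 else Real.exp (-L))
          ≤ ∑ j : Fin l, ((if j = c v then 1 else 0) + Real.exp (-L)) := by
            refine Finset.sum_le_sum fun j _ => ?_
            have := Real.exp_nonneg (-L)
            split_ifs <;> linarith
        _ = 1 + l * Real.exp (-L) := by simp [Finset.sum_add_distrib]
        _ ≤ κ / 2 + 1 := by linarith
        _ ≤ Real.exp (κ / 2) := Real.add_one_le_exp _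
    rw [h1]
    calc _ ≤ ∏ _v : Fin d, Real.exp (κ / 2) :=
          Finset.prod_le_prod (fun v _ => Finset.sum_nonneg fun j _ => by split_ifs <;> positivity)
            fun v _ => h2 v
      _ = _ := by rw [Finset.prod_const, Finset.card_fin, ← Real.exp_nat_mul, mul_comm]
  have hwball (b : Fin d → Fin l) (hb : ({v | b v ≠ c v}.ncard : ℝ) ≤ θ * d) :
      Real.exp (-(κ / 2 * d)) ≤ w b := by
    have h1 : w b = Real.exp (-L) ^ {v | b v ≠ c v}.ncard := by
      simp only [w]
      rw [Finset.prod_ite, Finset.prod_const_one, one_mul, Finset.prod_const,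
        Set.ncard_eq_toFinset_card']
      congr 2
      ext v
      simp
    rw [h1, ← Real.exp_nat_mul, Real.exp_le_exp]
    have h2 := mul_le_mul_of_nonneg_right hb hL0
    have h3 := mul_le_mul_of_nonneg_right hθL (Nat.cast_nonneg (α := ℝ) d)
    nlinarith
  set B := {b : Fin d → Fin l | ({v | b v ≠ c v}.ncard : ℝ) ≤ θ * d} with hB
  have hcard : (B.ncard : ℝ) * Real.exp (-(κ / 2 * d)) ≤ Real.exp (κ / 2 * d) := by
    rw [Set.ncard_eq_toFinset_card', ← nsmul_eq_mul]
    calc _ ≤ ∑ b ∈ B.toFinset, w b :=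
          Finset.card_nsmul_le_sum _ _ _ fun b hb => hwball b (by simpa [hB] using hb)
      _ ≤ ∑ b, w b := Finset.sum_le_sum_of_subset_of_nonneg (Finset.subset_univ _)
          fun b _ _ => hw0 b
      _ ≤ _ := hwsum
  have h4 : Real.exp (κ * d) = Real.exp (κ / 2 * d) * Real.exp (κ / 2 * d) := by
    rw [← Real.exp_add]; ring_nf
  rw [h4]
  have h5 := mul_le_mul_of_nonneg_right hcard (Real.exp_nonneg (κ / 2 * d))
  rwa [mul_assoc, ← Real.exp_add, neg_add_cancel, Real.exp_zero, mul_one] at h5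

end Hamming

/-! ### Frequencies in finite models -/

section Frequency

/-- The uniform probability of a set of points. -/
noncomputable def freq {d : ℕ} (s : Set (Fin d)) : ℝ := (s.ncard : ℝ) / d

lemma freq_mono {d : ℕ} {s t : Set (Fin d)} (h : s ⊆ t) : freq s ≤ freq t := by
  unfold freq
  gcongr
  exact Set.toFinite _

lemma freq_nonneg {d : ℕ} (s : Set (Fin d)) : 0 ≤ freq s := by unfold freq; positivity

lemma freq_union_le {d : ℕ} (s t : Set (Fin d)) : freq (s ∪ t) ≤ freq s + freq t := by
  unfold freq
  rw [← add_div]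
  gcongr
  exact_mod_cast Set.ncard_union_le s t

lemma freq_biUnion_le {d : ℕ} {ι : Type*} (T : Finset ι) (s : ι → Set (Fin d)) :
    freq (⋃ i ∈ T, s i) ≤ ∑ i ∈ T, freq (s i) := by
  classical
  induction T using Finset.induction_on with
  | empty => simp [freq]
  | insert a T ha ih =>
    rw [Finset.set_biUnion_insert, Finset.sum_insert ha]
    exact (freq_union_le _ _).trans (by gcongr)

lemma freq_compl {d : ℕ} (hd : d ≠ 0) (s : Set (Fin d)) : freq sᶜ = 1 - freq s := by
  have h : (s.ncard : ℝ) + (sᶜ.ncard : ℝ) = d := by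
    have := Set.ncard_add_ncard_compl s
    rw [Nat.card_fin] at this
    exact_mod_cast this
  have : (d : ℝ) ≠ 0 := by exact_mod_cast hd
  unfold freq
  field_simp
  linarith

lemma abs_freq_sub_le {d : ℕ} {s t B : Set (Fin d)} (h : ∀ v ∉ B, (v ∈ s ↔ v ∈ t)) :
    |freq s - freq t| ≤ freq B := by
  have h1 : s ⊆ t ∪ B := fun v hv => by
    by_cases hB : v ∈ B
    exacts [Or.inr hB, Or.inl ((h v hB).1 hv)]
  have h2 : t ⊆ s ∪ B := fun v hv => by
    by_cases hB : v ∈ B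
    exacts [Or.inr hB, Or.inl ((h v hB).2 hv)]
  have h3 := (freq_mono h1).trans (freq_union_le _ _)
  have h4 := (freq_mono h2).trans (freq_union_le _ _)
  exact abs_sub_le_iff.2 ⟨by linarith, by linarith⟩

lemma abs_measureReal_sub_le {X : Type*} [MeasurableSpace X] (μ : Measure X) [IsFiniteMeasure μ]
    {s t B : Set X} (h : ∀ x ∉ B, (x ∈ s ↔ x ∈ t)) : |μ.real s - μ.real t| ≤ μ.real B := by
  have h1 : s ⊆ t ∪ B := fun v hv => by
    by_cases hB : v ∈ B
    exacts [Or.inr hB, Or.inl ((h v hB).1 hv)]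
  have h2 : t ⊆ s ∪ B := fun v hv => by
    by_cases hB : v ∈ B
    exacts [Or.inr hB, Or.inl ((h v hB).2 hv)]
  have h3 := (measureReal_mono (μ := μ) h1).trans (measureReal_union_le _ _)
  have h4 := (measureReal_mono (μ := μ) h2).trans (measureReal_union_le _ _)
  exact abs_sub_le_iff.2 ⟨by linarith, by linarith⟩

end Frequency

/-! ### Statistics of microstates -/

section Models

variable {G X : Type*} [Group G] [MulAction G X] [MeasurableSpace X]

/-- Finitary statistics of a microstate are controlled by the partition distance. -/
theorem abs_measureReal_sub_freq_le (μ : Measure X) [IsFiniteMeasure μ] {d k : ℕ}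
    (σ : G → Equiv.Perm (Fin d)) {α : X → Fin k} (hα : Measurable (itinerary G α))
    (F : Finset G) (b : Fin d → Fin k) {P : Set (G → Fin k)}
    (hP : DependsOn (· ∈ P) (F : Set G)) :
    |μ.real (itinerary G α ⁻¹' P) - freq {v | modelItinerary σ b v ∈ P}| ≤
      partitionDist μ σ α F b := by
  classical
  let Q : Finset (F → Fin k) := Finset.univ.filter fun φ => ∃ c ∈ P, ∀ f : F, c f = φ f
  have hQ (c : G → Fin k) : c ∈ P ↔ (fun f : F => c f) ∈ Q := by
    simp only [Q, Finset.mem_filter, Finset.mem_univ, true_and]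
    refine ⟨fun h => ⟨c, h, fun _ => rfl⟩, ?_⟩
    rintro ⟨c', hc', h⟩
    exact (iff_of_eq (hP fun g hg => h ⟨g, hg⟩)).1 hc'
  have h1 : μ.real (itinerary G α ⁻¹' P) = ∑ φ ∈ Q, μ.real (partCylinder α F φ) := by
    have : itinerary G α ⁻¹' P = ⋃ φ ∈ Q, partCylinder α F φ := by
      ext x
      simp only [Set.mem_preimage, hQ, Set.mem_iUnion, partCylinder, Set.mem_ofPred_eq]
      refine ⟨fun h => ⟨_, h, fun _ => rfl⟩, ?_⟩
      rintro ⟨φ, hφ, h⟩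
      have : (fun f : F => itinerary G α x f) = φ := funext h
      rwa [this]
    rw [this, measureReal_biUnion_finset]
    · intro φ _ ψ _ hne
      refine Set.disjoint_left.2 fun x hx hx' => hne (funext fun f => ?_)
      exact (hx f).symm.trans (hx' f)
    · intro φ _
      have : partCylinder α F φ = ⋂ f : F, itinerary G α ⁻¹' {c | c f = φ f} := by
        ext x; simp [partCylinder, itinerary]
      rw [this]
      refine MeasurableSet.iInter fun f => hα ?_
      exact (measurable_pi_apply (X := fun _ : G => Fin k) (f : G)) (measurableSet_singleton _)
  have h2 : freq {v | modelItinerary σ b v ∈ P} =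
      ∑ φ ∈ Q, ((modelCylinder σ b F φ).ncard : ℝ) / d := by
    unfold freq
    rw [← Finset.sum_div, Set.ncard_eq_toFinset_card',
      Finset.card_eq_sum_card_fiberwise (f := fun v (f : F) => b (σ f v)) (t := Q)]
    · push_cast
      congr 1
      refine Finset.sum_congr rfl fun φ hφ => ?_
      rw [Set.ncard_eq_toFinset_card']
      congr 2
      ext v
      rw [Finset.mem_filter, Set.mem_toFinset, Set.mem_toFinset]
      refine ⟨fun h f => congrFun h.2 f, fun h => ⟨?_, funext h⟩⟩
      change modelItinerary σ b v ∈ P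
      rw [hQ]
      have : (fun f : F => modelItinerary σ b v f) = φ := funext h
      rwa [this]
    · intro v hv
      have : modelItinerary σ b v ∈ P := by simpa using hv
      exact (hQ _).1 this
  rw [h1, h2, ← Finset.sum_sub_distrib]
  refine (Finset.abs_sum_le_sum_abs _ _).trans ?_
  exact Finset.sum_le_sum_of_subset_of_nonneg (Finset.subset_univ _) fun _ _ _ => abs_nonneg _

end Models

/-! ### Almost multiplicativity and recoding -/

section Recoding

variable {G : Type*} [Group G]

/-- The points at which `σ` fails to be multiplicative on `T`. -/
def nonMultiplicative {d : ℕ} (σ : G → Equiv.Perm (Fin d)) (T : Finset G) : Set (Fin d) :=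
  {v | ∃ g ∈ T, ∃ h ∈ T, σ g (σ h v) ≠ σ (g * h) v}

theorem SoficApproximation.tendsto_freq_nonMultiplicative (S : SoficApproximation G)
    (T : Finset G) : Tendsto (fun i => freq (nonMultiplicative (S.σ i) T)) atTop (𝓝 0) := by
  have hpair (g h : G) :
      Tendsto (fun i => freq {v | S.σ i g (S.σ i h v) ≠ S.σ i (g * h) v}) atTop (𝓝 0) := by
    have h1 := (tendsto_const_nhds (x := (1 : ℝ))).sub (S.asymp_mul g h)
    rw [sub_self] at h1
    refine h1.congr' ?_
    filter_upwards [S.tendsto_d.eventually_ne_atTop 0] with i hi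
    exact (freq_compl hi _).symm
  have hsum : Tendsto (fun i => ∑ g ∈ T, ∑ h ∈ T,
      freq {v | S.σ i g (S.σ i h v) ≠ S.σ i (g * h) v}) atTop (𝓝 0) := by
    simpa using tendsto_finsetSum T fun g _ => tendsto_finsetSum T fun h _ => hpair g h
  refine squeeze_zero (fun i => freq_nonneg _) (fun i => ?_) hsum
  have : nonMultiplicative (S.σ i) T =
      ⋃ g ∈ T, ⋃ h ∈ T, {v | S.σ i g (S.σ i h v) ≠ S.σ i (g * h) v} := by
    ext v; simp [nonMultiplicative]
  rw [this]
  exact (freq_biUnion_le _ _).trans (Finset.sum_le_sum fun g _ => freq_biUnion_le _ _)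

/-- Off the non-multiplicative points, recoding a microstate agrees with recoding its names. -/
lemma modelItinerary_recode {d k l : ℕ} {σ : G → Equiv.Perm (Fin d)} {T : Finset G}
    {q : (G → Fin l) → Fin k} (hq : DependsOn q (T : Set G)) (b : Fin d → Fin l) {v : Fin d}
    (hv : v ∉ nonMultiplicative σ T) {h : G} (hh : h ∈ T) :
    modelItinerary σ (fun v => q (modelItinerary σ b v)) v h =
      blockCode q (modelItinerary σ b v) h := by
  refine hq fun g hg => congrArg b ?_
  by_contra hne
  exact hv ⟨g, hg, h, hh, hne⟩

end Recoding

/-! ### Independence of the generating partition -/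

section Comparison

variable {G X : Type*} [Group G] [MulAction G X] [MeasurableSpace X]

/-- If the `α`-name is close to the recoded `β`-name, a microstate for `β` with good statistics
recodes to a microstate for `α`. -/
theorem recode_mem_AP {μ : Measure X} [IsFiniteMeasure μ] {d k l : ℕ}
    {σ : G → Equiv.Perm (Fin d)} {α : X → Fin k} {β : X → Fin l}
    (hβ : Measurable (itinerary G β)) {F T₁ T F' : Finset G} {q : (G → Fin l) → Fin k} {ε₀ : ℝ}
    (hq : DependsOn q (T : Set G)) (hFT : F ⊆ T₁) (hT : T₁ ⊆ T)
    (hF' : ∀ g ∈ T, ∀ h ∈ T, g * h ∈ F')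
    (hμ : μ.real {x | ∃ h ∈ T₁, itinerary G α x h ≠ blockCode q (itinerary G β x) h} ≤ ε₀)
    (hσ : freq (nonMultiplicative σ T) ≤ ε₀) {b : Fin d → Fin l} (hb : b ∈ AP μ σ β F' ε₀) :
    (fun v => q (modelItinerary σ b v)) ∈
      AP μ σ α F (Nat.card (F → Fin k) * (3 * ε₀)) := by
  classical
  set a : Fin d → Fin k := fun v => q (modelItinerary σ b v) with ha
  -- Three errors of size `ε₀`: recoding the name in `X`, the statistics of `b` on `F'`, and
  -- failures of multiplicativity.
  have hterm (φ : F → Fin k) : |μ.real (partCylinder α F φ) -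
      ((modelCylinder σ a F φ).ncard : ℝ) / (d : ℝ)| ≤ 3 * ε₀ := by
    let P : Set (G → Fin l) := {c | ∀ f : F, blockCode q c f = φ f}
    have hP : DependsOn (· ∈ P) (F' : Set G) := by
      intro c c' hcc
      have (f : F) : blockCode q c f = blockCode q c' f :=
        hq fun g hg => hcc _ (hF' g hg f (hT (hFT f.2)))
      simp only [P, Set.mem_ofPred_eq, this]
    have h1 : |μ.real (partCylinder α F φ) - μ.real (itinerary G β ⁻¹' P)| ≤ ε₀ := by
      refine (abs_measureReal_sub_le μ fun x hx => ?_).trans hμ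
      have hx' (f : F) : itinerary G α x f = blockCode q (itinerary G β x) f := by
        by_contra hne
        exact hx ⟨f, hFT f.2, hne⟩
      simp only [P, Set.mem_preimage, Set.mem_ofPred_eq, ← hx']
      rfl
    have h2 := (abs_measureReal_sub_freq_le μ σ hβ F' b hP).trans hb
    have h3 : |freq {v | modelItinerary σ b v ∈ P} - freq (modelCylinder σ a F φ)| ≤ ε₀ := by
      refine (abs_freq_sub_le fun v hv => ?_).trans hσ
      simp only [P, Set.mem_ofPred_eq]
      refine forall_congr' fun f => ?_
      rw [← modelItinerary_recode hq b hv (hT (hFT f.2))]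
      rfl
    change |μ.real (partCylinder α F φ) - freq (modelCylinder σ a F φ)| ≤ 3 * ε₀
    rw [abs_le] at h1 h2 h3 ⊢
    exact ⟨by linarith, by linarith⟩
  refine (Finset.sum_le_card_nsmul _ _ _ fun φ _ => hterm φ).trans ?_
  rw [Finset.card_univ, nsmul_eq_mul, Nat.card_eq_fintype_card]

/-- If moreover `β` is close to a finitary function of the `α`-name, a microstate for `β` is
recovered from its recoding up to a small error. -/
theorem freq_ne_recode_le {μ : Measure X} [IsFiniteMeasure μ] {d k l : ℕ}
    {σ : G → Equiv.Perm (Fin d)} {α : X → Fin k} {β : X → Fin l}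
    (hβ : Measurable (itinerary G β)) {T₁ T F' : Finset G} {q : (G → Fin l) → Fin k}
    {p : (G → Fin k) → Fin l} {ε₀ : ℝ} (hq : DependsOn q (T : Set G))
    (hp : DependsOn p (T₁ : Set G)) (hT : T₁ ⊆ T) (h1T : 1 ∈ T)
    (hF' : ∀ g ∈ T, ∀ h ∈ T, g * h ∈ F')
    (hμ : μ.real {x | ∃ h ∈ T₁, itinerary G α x h ≠ blockCode q (itinerary G β x) h} ≤ ε₀)
    (hμ' : μ.real {x | β x ≠ p (itinerary G α x)} ≤ ε₀)
    (hσ : freq (nonMultiplicative σ T) ≤ ε₀) {b : Fin d → Fin l} (hb : b ∈ AP μ σ β F' ε₀) :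
    freq {v | b v ≠ p (modelItinerary σ (fun v => q (modelItinerary σ b v)) v)} ≤ 4 * ε₀ := by
  -- Names whose label at `1` is lost by recoding and decoding. Mass `2 * ε₀` in `X` becomes
  -- frequency `3 * ε₀` along `b`; non-multiplicative points add the fourth `ε₀`.
  let D : Set (G → Fin l) := {c | c 1 ≠ p (blockCode q c)}
  have hD : DependsOn (· ∈ D) (F' : Set G) := by
    intro c c' hcc
    have h1 : p (blockCode q c) = p (blockCode q c') :=
      hp fun h hh => hq fun g hg => hcc _ (hF' g hg h (hT hh))
    have h2 : c 1 = c' 1 := hcc 1 (by simpa using hF' 1 h1T 1 h1T)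
    simp only [D, Set.mem_ofPred_eq, h1, h2]
  have hμD : μ.real (itinerary G β ⁻¹' D) ≤ 2 * ε₀ := by
    have hsub : itinerary G β ⁻¹' D ⊆ {x | β x ≠ p (itinerary G α x)} ∪
        {x | ∃ h ∈ T₁, itinerary G α x h ≠ blockCode q (itinerary G β x) h} := by
      intro x hx
      by_contra hcon
      simp only [Set.mem_union, Set.mem_ofPred_eq, not_or, not_exists, not_and, not_not] at hcon
      apply hx
      rw [← hp fun h hh => hcon.2 h hh, ← hcon.1]
      simp [itinerary]
    linarith [(measureReal_mono (μ := μ) hsub).trans (measureReal_union_le _ _)]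
  have h2 := (abs_le.1 ((abs_measureReal_sub_freq_le μ σ hβ F' b hD).trans hb)).1
  have hsub : {v | b v ≠ p (modelItinerary σ (fun v => q (modelItinerary σ b v)) v)} ⊆
      {v | modelItinerary σ b v ∈ D} ∪ nonMultiplicative σ T := by
    intro v hv
    by_cases hvT : v ∈ nonMultiplicative σ T
    · exact Or.inr hvT
    refine Or.inl fun heq => hv ?_
    -- `σ 1` need not be the identity, but multiplicativity at `(1, 1)` and injectivity make it fix
    -- `v`.
    have h1 : σ 1 v = v := by
      by_contra hne
      refine hvT ⟨1, h1T, 1, h1T, fun h => hne ?_⟩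
      rw [one_mul] at h
      exact (σ 1).injective h
    rw [hp fun h hh => modelItinerary_recode hq b hvT (hT hh), ← heq]
    simp [modelItinerary, h1]
  linarith [(freq_mono hsub).trans (freq_union_le _ _)]

/-- Microstate counts for two generating partitions compare up to a small exponential factor. -/
theorem eventually_card_AP_le (S : SoficApproximation G) {μ : Measure X} [IsProbabilityMeasure μ]
    (hG : ∀ g : G, Measurable fun x : X => g • x)
    (hinv : ∀ (g : G) (A : Set X), MeasurableSet A → μ ((fun x => g • x) ⁻¹' A) = μ A)
    {k l : ℕ} {α : X → Fin k} {β : X → Fin l} (hα : IsGenerating G μ α)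
    (hβ : IsGenerating G μ β) (F : Finset G) {ε κ : ℝ} (hε : 0 < ε) (hκ : 0 < κ) :
    ∃ (F' : Finset G) (ε' : ℝ), F'.Nonempty ∧ 0 < ε' ∧ ∀ᶠ i in atTop,
      ((AP μ (S.σ i) β F' ε').ncard : ℝ) ≤
        (AP μ (S.σ i) α F ε).ncard * Real.exp (κ * S.d i) := by
  classical
  obtain ⟨θ, hθ, hball⟩ := exists_card_hammingBall_le l hκ
  set N : ℝ := (Nat.card (F → Fin k) : ℝ)
  have hN0 : 0 ≤ N := Nat.cast_nonneg _
  obtain ⟨ε₀, hε₀, hε₀θ, hε₀N⟩ : ∃ ε₀ : ℝ, 0 < ε₀ ∧ 4 * ε₀ ≤ θ ∧ N * (3 * ε₀) ≤ ε := by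
    refine ⟨min (θ / 4) (ε / (3 * (N + 1))), by positivity, ?_, ?_⟩
    · linarith [min_le_left (θ / 4) (ε / (3 * (N + 1)))]
    · have h1 := min_le_right (θ / 4) (ε / (3 * (N + 1)))
      rw [le_div_iff₀ (by positivity)] at h1
      have h2 : 0 < min (θ / 4) (ε / (3 * (N + 1))) := by positivity
      nlinarith
  obtain ⟨E₁, p, hp, hpμ⟩ := hα.exists_block_approx hG hβ.1 hε₀
  have hβm := measurable_itinerary hβ.1 hG
  let T₁ : Finset G := insert 1 (E₁ ∪ F)
  have hT₁ : 0 < (T₁.card : ℝ) := by exact_mod_cast Finset.card_pos.2 ⟨1, by simp [T₁]⟩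
  -- The error is divided by the size of `T₁` because, by invariance, the translates of the bad set
  -- over `T₁` have equal mass and are summed.
  obtain ⟨E₂, q, hq, hqμ⟩ := hβ.exists_block_approx hG hα.1 (ε := ε₀ / T₁.card) (by positivity)
  let T : Finset G := T₁ ∪ E₂
  have hT : T₁ ⊆ T := Finset.subset_union_left
  have h1T : (1 : G) ∈ T := hT (by simp [T₁])
  have hFT : F ⊆ T₁ := fun g hg => by simp [T₁, hg]
  replace hp : DependsOn p (T₁ : Set G) := hp.mono fun g hg => by
    simp only [T₁, Finset.coe_insert, Finset.coe_union]
    exact Or.inr (Or.inl hg)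
  replace hq : DependsOn q (T : Set G) := hq.mono fun g hg => by
    simp only [T, Finset.coe_union]
    exact Or.inr hg
  let F' : Finset G := Finset.image₂ (· * ·) T T
  have hF' : ∀ g ∈ T, ∀ h ∈ T, g * h ∈ F' := fun g hg h hh => Finset.mem_image₂_of_mem hg hh
  have hμ : μ.real {x | ∃ h ∈ T₁, itinerary G α x h ≠ blockCode q (itinerary G β x) h} ≤ ε₀ := by
    let B : Set X := {x | α x ≠ q (itinerary G β x)}
    have hB : MeasurableSet B := by
      have := measurableSet_eq_fun hα.1 (hq.measurable.comp hβm)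
      exact this.compl
    have heq : {x | ∃ h ∈ T₁, itinerary G α x h ≠ blockCode q (itinerary G β x) h} =
        ⋃ h ∈ T₁, (fun x => h • x) ⁻¹' B := by
      ext x
      simp only [Set.mem_ofPred_eq, Set.mem_iUnion, Set.mem_preimage, B, itinerary_smul,
        exists_prop]
      rfl
    rw [heq]
    calc _ ≤ ∑ h ∈ T₁, μ.real ((fun x => h • x) ⁻¹' B) := measureReal_biUnion_finset_le _ _
      _ = T₁.card * μ.real B := by
        simp only [Measure.real, hinv _ _ hB, Finset.sum_const, nsmul_eq_mul]
      _ ≤ T₁.card * (ε₀ / T₁.card) := by gcongr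
      _ = ε₀ := by field_simp
  refine ⟨F', ε₀, ⟨_, hF' 1 h1T 1 h1T⟩, hε₀, ?_⟩
  filter_upwards [(S.tendsto_freq_nonMultiplicative T).eventually_le_const hε₀,
    S.tendsto_d.eventually_gt_atTop 0] with i hσ hd
  have hd' : (0 : ℝ) < S.d i := by exact_mod_cast hd
  let ball : (Fin (S.d i) → Fin k) → Set (Fin (S.d i) → Fin l) := fun a =>
    {b | ({v | b v ≠ p (modelItinerary (S.σ i) a v)}.ncard : ℝ) ≤ θ * S.d i}
  -- Each `β`-microstate lies in the ball around the decoding of its own recoding.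
  have hsub : (AP μ (S.σ i) β F' ε₀).toFinset ⊆
      (AP μ (S.σ i) α F ε).toFinset.biUnion fun a => (ball a).toFinset := by
    intro b hb
    rw [Set.mem_toFinset] at hb
    simp only [Finset.mem_biUnion, Set.mem_toFinset]
    refine ⟨_, (recode_mem_AP hβm hq hFT hT hF' hμ hσ hb : partitionDist _ _ _ _ _ ≤ _).trans
      hε₀N, ?_⟩
    have h := (freq_ne_recode_le hβm hq hp hT h1T hF' hμ hpμ.le hσ hb).trans hε₀θ
    exact (div_le_iff₀ hd').1 h
  rw [Set.ncard_eq_toFinset_card', Set.ncard_eq_toFinset_card']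
  calc ((AP μ (S.σ i) β F' ε₀).toFinset.card : ℝ)
      ≤ ∑ a ∈ (AP μ (S.σ i) α F ε).toFinset, ((ball a).toFinset.card : ℝ) := by
        exact_mod_cast (Finset.card_le_card hsub).trans Finset.card_biUnion_le
    _ ≤ ∑ a ∈ (AP μ (S.σ i) α F ε).toFinset, Real.exp (κ * S.d i) := by
        refine Finset.sum_le_sum fun a _ => ?_
        rw [← Set.ncard_eq_toFinset_card']
        exact hball _ _
    _ = _ := by rw [Finset.sum_const, nsmul_eq_mul]

/-- The entropy computed with one generating partition is at most that computed with another. -/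
theorem partitionEntropy_le (S : SoficApproximation G) {μ : Measure X} [IsProbabilityMeasure μ]
    (hG : ∀ g : G, Measurable fun x : X => g • x)
    (hinv : ∀ (g : G) (A : Set X), MeasurableSet A → μ ((fun x => g • x) ⁻¹' A) = μ A)
    {k l : ℕ} {α : X → Fin k} {β : X → Fin l} (hα : IsGenerating G μ α)
    (hβ : IsGenerating G μ β) : partitionEntropy S μ β ≤ partitionEntropy S μ α := by
  refine le_iInf₂ fun F _ => le_iInf₂ fun ε hε => ?_
  -- Testing against reals `c` above the target leaves a gap `c - c'` to absorb the exponential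
  -- factor, and covers the value `-∞` too.
  refine EReal.le_of_forall_lt_iff_le.1 fun c hc => ?_
  obtain ⟨c', h1, h2⟩ := EReal.lt_iff_exists_real_btwn.1 hc
  have hκ : 0 < c - c' := sub_pos.2 (EReal.coe_lt_coe_iff.1 h2)
  obtain ⟨F', ε', hF', hε', hle⟩ := eventually_card_AP_le S hG hinv hα hβ F hε hκ
  refine (iInf₂_le_of_le F' hF' (iInf₂_le ε' hε')).trans ?_
  refine limsup_le_of_le (by isBoundedDefault) ?_
  filter_upwards [hle, eventually_lt_of_limsup_lt h1, S.tendsto_d.eventually_gt_atTop 0]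
    with i hi hci hd
  have hd0 : (0 : EReal) < (S.d i : EReal) := by exact_mod_cast hd
  have hdt : (S.d i : EReal) ≠ ⊤ := EReal.natCast_ne_top _
  rw [EReal.div_le_iff_le_mul hd0 hdt]
  rw [EReal.div_lt_iff hd0 hdt] at hci
  have hi' : (((AP μ (S.σ i) β F' ε').ncard : ℕ) : ℝ≥0∞) ≤
      (AP μ (S.σ i) α F ε).ncard * ENNReal.ofReal (Real.exp ((c - c') * S.d i)) := by
    rw [← ENNReal.ofReal_natCast, ← ENNReal.ofReal_natCast,
      ← ENNReal.ofReal_mul (Nat.cast_nonneg _)]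
    exact ENNReal.ofReal_le_ofReal hi
  refine (ENNReal.log_le_log hi').trans ?_
  rw [ENNReal.log_mul_add, ENNReal.log_ofReal_of_pos (Real.exp_pos _), Real.log_exp]
  refine (add_le_add_left hci.le _).trans (le_of_eq ?_)
  rw [← EReal.coe_natCast]
  norm_cast
  ring

end Comparison

/-! ### Possible values of the entropy -/

section Range

variable {G X : Type*} [Group G] [MulAction G X] [MeasurableSpace X]

/-- Counts are integers: either microstates exist for infinitely many `i`, with non-negative
logarithms, or the sequence is eventually `-∞`. -/
theorem entropyAt_eq_bot_or_nonneg (S : SoficApproximation G) (μ : Measure X) {k : ℕ}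
    (α : X → Fin k) (F : Finset G) (ε : ℝ) :
    entropyAt S μ α F ε = ⊥ ∨ 0 ≤ entropyAt S μ α F ε := by
  by_cases h : ∃ᶠ i in atTop, (AP μ (S.σ i) α F ε).ncard ≠ 0
  · right
    refine le_limsup_of_frequently_le (h.mono fun i hi => ?_) (by isBoundedDefault)
    refine EReal.div_nonneg ?_ (by positivity)
    rw [ENNReal.zero_le_log_iff]
    exact_mod_cast Nat.one_le_iff_ne_zero.2 hi
  · left
    rw [not_frequently] at h
    refine (limsup_congr ?_).trans limsup_const_bot
    filter_upwards [h, S.tendsto_d.eventually_gt_atTop 0] with i hi hd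
    rw [not_not.1 hi, Nat.cast_zero, ENNReal.log_zero,
      EReal.bot_div_of_pos_ne_top (by exact_mod_cast hd) (EReal.natCast_ne_top _)]

theorem entropyAt_lt_top (S : SoficApproximation G) (μ : Measure X) {k : ℕ}
    (α : X → Fin k) (F : Finset G) (ε : ℝ) : entropyAt S μ α F ε < ⊤ := by
  refine lt_of_le_of_lt ?_ (EReal.natCast_ne_top k).lt_top
  refine limsup_le_of_le (by isBoundedDefault) ?_
  filter_upwards [S.tendsto_d.eventually_gt_atTop 0] with i hd
  rw [EReal.div_le_iff_le_mul (by exact_mod_cast hd) (EReal.natCast_ne_top _)]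
  have h1 : ((AP μ (S.σ i) α F ε).ncard : ℝ) ≤ Real.exp (S.d i * k) := by
    have h2 : (AP μ (S.σ i) α F ε).ncard ≤ k ^ S.d i := (Set.ncard_le_card _).trans (by simp)
    rw [Real.exp_nat_mul]
    refine (Nat.cast_le.2 h2).trans ?_
    push_cast
    gcongr
    linarith [Real.add_one_le_exp (k : ℝ)]
  rw [← ENNReal.ofReal_natCast]
  refine (ENNReal.log_le_log (ENNReal.ofReal_le_ofReal h1)).trans (le_of_eq ?_)
  rw [ENNReal.log_ofReal_of_pos (Real.exp_pos _), Real.log_exp]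
  push_cast
  rfl

theorem partitionEntropy_eq_bot_or (S : SoficApproximation G) (μ : Measure X) {k : ℕ}
    (α : X → Fin k) :
    partitionEntropy S μ α = ⊥ ∨ (0 ≤ partitionEntropy S μ α ∧ partitionEntropy S μ α < ⊤) := by
  by_cases h : ∃ (F : Finset G) (_ : F.Nonempty) (ε : ℝ) (_ : 0 < ε), entropyAt S μ α F ε = ⊥
  · obtain ⟨F, hF, ε, hε, h⟩ := h
    exact Or.inl (le_bot_iff.1 ((iInf₂_le_of_le F hF (iInf₂_le ε hε)).trans h.le))
  · push Not at h
    refine Or.inr ⟨le_iInf₂ fun F hF => le_iInf₂ fun ε hε =>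
      (entropyAt_eq_bot_or_nonneg S μ α F ε).resolve_left (h F hF ε hε), ?_⟩
    exact (iInf₂_le_of_le {1} (by simp) (iInf₂_le 1 one_pos)).trans_lt
      (entropyAt_lt_top S μ α {1} 1)

end Range

/-! ### Dependence on the measure -/

section Semicontinuity

variable {G X : Type*} [Group G] [MulAction G X] [MeasurableSpace X]

open Classical in
lemma partitionDist_le (μ ν : Measure X) {d k : ℕ} (σ : G → Equiv.Perm (Fin d)) (α : X → Fin k)
    (F : Finset G) (b : Fin d → Fin k) :
    partitionDist μ σ α F b ≤ partitionDist ν σ α F b +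
      ∑ φ : F → Fin k, |ν.real (partCylinder α F φ) - μ.real (partCylinder α F φ)| := by
  unfold partitionDist
  rw [← Finset.sum_add_distrib]
  refine Finset.sum_le_sum fun φ _ => ?_
  have := abs_sub_le (μ.real (partCylinder α F φ)) (ν.real (partCylinder α F φ))
    ((modelCylinder σ b F φ).ncard / d)
  rw [abs_sub_comm (μ.real _) (ν.real _)] at this
  linarith

lemma entropyAt_mono (S : SoficApproximation G) {μ ν : Measure X} {k : ℕ} {α : X → Fin k}
    {F : Finset G} {ε ε' : ℝ} (h : ∀ i, AP ν (S.σ i) α F ε' ⊆ AP μ (S.σ i) α F ε) :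
    entropyAt S ν α F ε' ≤ entropyAt S μ α F ε := by
  refine limsup_le_limsup (Eventually.of_forall fun i => ?_)
  refine EReal.div_le_div_right_of_nonneg (by positivity) (ENNReal.log_le_log ?_)
  exact_mod_cast Set.ncard_le_ncard (h i)

/-- Cylinder sets of a labelling that is locally constant off an invariantly null set have null
boundary. -/
lemma measure_frontier_partCylinder [TopologicalSpace X] [ContinuousConstSMul G X] {μ : Measure X}
    (hinv : ∀ (g : G) (A : Set X), MeasurableSet A → μ ((fun x => g • x) ⁻¹' A) = μ A)
    {k : ℕ} {α : X → Fin k} {N : Set X} (hN : MeasurableSet N) (hN0 : μ N = 0)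
    (hα : ∀ x ∉ N, ∀ᶠ y in 𝓝 x, α y = α x) (F : Finset G) (φ : F → Fin k) :
    μ (frontier (partCylinder α F φ)) = 0 := by
  refine measure_mono_null (t := ⋃ f ∈ F, (fun x => f • x) ⁻¹' N) (fun x hx => ?_)
    ((measure_biUnion_null_iff F.countable_toSet).2 fun f _ => by rw [hinv f N hN, hN0])
  by_contra hxN
  simp only [Set.mem_iUnion, Set.mem_preimage, not_exists] at hxN
  have hev : ∀ᶠ y in 𝓝 x, (y ∈ partCylinder α F φ ↔ x ∈ partCylinder α F φ) := by
    have : ∀ f : F, ∀ᶠ y in 𝓝 x, α ((f : G) • y) = α ((f : G) • x) := fun f =>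
      (continuous_const_smul (f : G)).continuousAt.eventually (hα _ (hxN f f.2))
    filter_upwards [eventually_all.2 this] with y hy
    exact forall_congr' fun f => by rw [hy f]
  by_cases hxc : x ∈ partCylinder α F φ
  · exact hx.2 (mem_interior_iff_mem_nhds.2 (hev.mono fun y hy => hy.2 hxc))
  · rw [frontier_eq_closure_inter_closure] at hx
    obtain ⟨y, hy, hyc⟩ := (mem_closure_iff_frequently.1 hx.1).and_eventually hev |>.exists
    exact hxc (hyc.1 hy)

end Semicontinuity

/-! ### Upper semicontinuity and compactness -/

section Main

variable {G X : Type*} [Group G] [MetricSpace X] [MeasurableSpace X] [BorelSpace X]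
  [MulAction G X] [ContinuousConstSMul G X]

theorem partitionEntropy_eq_soficEntropy (S : SoficApproximation G) (μ : InvariantMeasures G X)
    {k : ℕ} {α : X → Fin k} (hα : IsGenerating G (μ.1 : Measure X) α) :
    partitionEntropy S (μ.1 : Measure X) α = soficEntropy S (μ.1 : Measure X) := by
  refine le_antisymm (le_iInf fun l => le_iInf₂ fun β hβ => ?_)
    (iInf_le_of_le k (iInf₂_le α hα))
  exact partitionEntropy_le S (fun g => (continuous_const_smul g).measurable) μ.2 hβ hα

theorem upperSemicontinuous_soficEntropy [Countable G] [CompactSpace X] (S : SoficApproximation G)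
    (hexp : IsExpansive G X) : UpperSemicontinuous fun μ : InvariantMeasures G X =>
      soficEntropy S (μ.1 : Measure X) := by
  classical
  intro μ y hy
  -- `α` is adapted to `μ` but generates for every `ν`, so it computes all the entropies compared
  -- below.
  obtain ⟨k, α, hgen, N, hN, hN0, hloc⟩ :=
    exists_isGenerating_locallyConstant hexp (μ.1 : Measure X)
  simp only [← partitionEntropy_eq_soficEntropy S _ (hgen _)] at hy ⊢
  simp only [partitionEntropy, iInf_lt_iff] at hy
  obtain ⟨F, hF, ε, hε, hy⟩ := hy
  have hlim : Tendsto (fun ν : InvariantMeasures G X => ∑ φ : F → Fin k,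
      |(ν.1 : Measure X).real (partCylinder α F φ) -
        (μ.1 : Measure X).real (partCylinder α F φ)|) (𝓝 μ) (𝓝 0) := by
    have : Tendsto (fun ν : InvariantMeasures G X => ∑ φ : F → Fin k,
      |(ν.1 : Measure X).real (partCylinder α F φ) -
        (μ.1 : Measure X).real (partCylinder α F φ)|) (𝓝 μ) (𝓝 (∑ φ : F → Fin k,
      |(μ.1 : Measure X).real (partCylinder α F φ) -
        (μ.1 : Measure X).real (partCylinder α F φ)|)) := by
      refine tendsto_finsetSum _ fun φ _ => ((Tendsto.sub_const ?_ _).abs)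
      exact (ENNReal.tendsto_toReal (measure_ne_top _ _)).comp
        (ProbabilityMeasure.tendsto_measure_of_null_frontier_of_tendsto'
          (continuous_subtype_val.tendsto μ)
          (measure_frontier_partCylinder μ.2 hN hN0 hloc F φ))
    simpa using this
  filter_upwards [hlim.eventually_le_const (half_pos hε)] with ν hν
  refine (iInf₂_le_of_le F hF (iInf₂_le (ε / 2) (half_pos hε))).trans_lt
    (lt_of_le_of_lt (entropyAt_mono S fun i b hb => ?_) hy)
  have hb' : partitionDist (ν.1 : Measure X) (S.σ i) α F b ≤ ε / 2 := hb
  have := partitionDist_le (μ.1 : Measure X) (ν.1 : Measure X) (S.σ i) α F b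
  change partitionDist _ _ _ _ _ ≤ ε
  linarith

/-- The space of invariant measures of an action on a compact space is compact. -/
theorem compactSpace_invariantMeasures [CompactSpace X] :
    CompactSpace (InvariantMeasures G X) := by
  refine isCompact_iff_compactSpace.1 (IsClosed.isCompact ?_)
  -- Invariance is a fixed-point condition for push-forwards, which are weak-* continuous, hence it
  -- is closed.
  have heq : {μ : ProbabilityMeasure X | ∀ (g : G) (A : Set X), MeasurableSet A →
      (μ : Measure X) ((fun x => g • x) ⁻¹' A) = (μ : Measure X) A} =
      ⋂ g : G, {μ : ProbabilityMeasure X |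
        μ.map (continuous_const_smul g).measurable.aemeasurable = μ} := by
    ext μ
    simp only [Set.mem_ofPred_eq, Set.mem_iInter]
    refine forall_congr' fun g => ?_
    refine Iff.trans ?_ (Subtype.ext_iff (a1 := μ.map _) (a2 := μ)).symm
    change _ ↔ ((μ.map _ : ProbabilityMeasure X) : Measure X) = μ
    refine ⟨fun h => Measure.ext fun A hA => ?_, fun h A hA => ?_⟩
    · rw [ProbabilityMeasure.toMeasure_map,
        Measure.map_apply (continuous_const_smul g).measurable hA]
      exact h A hA
    · rw [ProbabilityMeasure.toMeasure_map] at h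
      rw [← Measure.map_apply (continuous_const_smul g).measurable hA, h]
  change IsClosed {μ : ProbabilityMeasure X | ∀ (g : G) (A : Set X), MeasurableSet A →
      (μ : Measure X) ((fun x => g • x) ⁻¹' A) = (μ : Measure X) A}
  rw [heq]
  exact isClosed_iInter fun g => isClosed_eq
    (ProbabilityMeasure.continuous_map (continuous_const_smul g)) continuous_id

end Main

end SoficEntropy

theorem mainTheorem7 {G : Type*} [Group G] [Countable G]
    {X : Type*} [MetricSpace X] [CompactSpace X] [MeasurableSpace X] [BorelSpace X]
    [MulAction G X] [ContinuousConstSMul G X]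
    (S : SoficEntropy.SoficApproximation G)
    (hexp : SoficEntropy.IsExpansive G X)
    (hne : Nonempty (SoficEntropy.InvariantMeasures G X)) :
    -- the entropy is well defined: finite generating partitions exist, and all give its value
    (∀ μ : SoficEntropy.InvariantMeasures G X,
      (∃ (k : ℕ) (α : X → Fin k), SoficEntropy.IsGenerating G (μ.1 : Measure X) α) ∧
      ∀ (k : ℕ) (α : X → Fin k), SoficEntropy.IsGenerating G (μ.1 : Measure X) α →
        SoficEntropy.partitionEntropy S (μ.1 : Measure X) α =
          SoficEntropy.soficEntropy S (μ.1 : Measure X)) ∧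
    -- it takes values in `[0, ∞) ∪ {-∞}`
    (∀ μ : SoficEntropy.InvariantMeasures G X,
      SoficEntropy.soficEntropy S (μ.1 : Measure X) = ⊥ ∨
        (0 ≤ SoficEntropy.soficEntropy S (μ.1 : Measure X) ∧
          SoficEntropy.soficEntropy S (μ.1 : Measure X) < ⊤)) ∧
    -- it is upper semicontinuous on `M(X, G)`
    UpperSemicontinuous (fun μ : SoficEntropy.InvariantMeasures G X =>
      SoficEntropy.soficEntropy S (μ.1 : Measure X)) ∧
    -- there is a measure of maximal entropy
    ∃ μ : SoficEntropy.InvariantMeasures G X, ∀ ν : SoficEntropy.InvariantMeasures G X,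
      SoficEntropy.soficEntropy S (ν.1 : Measure X) ≤
        SoficEntropy.soficEntropy S (μ.1 : Measure X) := by

  have husc := SoficEntropy.upperSemicontinuous_soficEntropy S hexp
  have hgen (μ : SoficEntropy.InvariantMeasures G X) :
      ∃ (k : ℕ) (α : X → Fin k), SoficEntropy.IsGenerating G (μ.1 : Measure X) α := by
    obtain ⟨k, α, hα, -⟩ :=
      SoficEntropy.exists_isGenerating_locallyConstant hexp (μ.1 : Measure X)
    exact ⟨k, α, hα _⟩
  refine ⟨fun μ => ⟨hgen μ, fun k α hα =>
    SoficEntropy.partitionEntropy_eq_soficEntropy S μ hα⟩, fun μ => ?_, husc, ?_⟩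
  · obtain ⟨k, α, hα⟩ := hgen μ
    rw [← SoficEntropy.partitionEntropy_eq_soficEntropy S μ hα]
    exact SoficEntropy.partitionEntropy_eq_bot_or S _ α
  · have := SoficEntropy.compactSpace_invariantMeasures (G := G) (X := X)
    obtain ⟨μ, -, hμ⟩ := UpperSemicontinuousOn.exists_isMaxOn Set.univ_nonempty isCompact_univ
      (husc.upperSemicontinuousOn Set.univ)
    exact ⟨μ, fun ν => hμ (Set.mem_univ ν)⟩
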